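/- Let $l,w\ge 1$ be integers and let $i\in\{1,2\}$. Let $\mathcal V_{l,w}=\{(x,y)\in\mathbb Z^2: 0\le x\le l,\ 0\le y\le w\}$ and let $\mathcal E_{l,w}$ be the set of all segments joining two points $(x,y),(x',y')\in\mathcal V_{l,w}$ with $|x-x'|=|y-y'|=1$. Let $V^{(i)}_{l,w}$ be the set of the points of $\mathcal V_{l,w}$ with $x+y$ even if $i=1$, and with $x+y$ odd if $i=2$; let $E^{(i)}_{l,w}$ be the set of the segments in $\mathcal E_{l,w}$ with endpoints in $V^{(i)}_{l,w}$. The hammock network $H^{(i)}_{l,w}$ has node set $V^{(i)}_{l,w}$, edge set $E^{(i)}_{l,w}$, the nodes on the line $x=0$ as sources and the nodes on the line $x=l$ as termini. Its dual network $\overline{H^{(i)}_{l,w}}$ has node set $\mathcal V_{l,w}\setminus V^{(i)}_{l,w}$, edge set $\mathcal E_{l,w}\setminus E^{(i)}_{l,w}$, the nodes on the line $y=0$ as sources and the nodes on the line $y=w$ as termini. For an edge $e\in\mathcal E_{l,w}$ joining $(x,y)$ and $(x',y')$, the complementary edge $\bar e$ is the segment joining $(x',y)$ and $(x,y')$, which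 crosses $e$. In each of these networks, a set of edges is a pathset if it contains all edges of some path, with pairwise distinct nodes, from a source to a terminus; a set of edges is a cutset if its complement in the edge set of the network is not a pathset. A minpath (respectively mincut) is a pathset (respectively cutset) $P$ such that, for every $e\in P$, $P\setminus\{e\}$ is no longer a pathset (respectively cutset). Let $\Sigma\subset E^{(i)}_{l,w}$ and $\overline\Sigma=\{\bar e: e\in\Sigma\}$. Then: i) if $\Sigma$ is a mincut in $H^{(i)}_{l,w}$, then $\overline\Sigma$ is a minpath in $\overline{H^{(i)}_{l,w}}$; ii) if $\Sigma$ is a minpath in $H^{(i)}_{l,w}$, then $\overline\Sigma$ is a mincut in $\overline{H^{(i)}_{l,w}}$. -/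

import Mathlib

namespace Hammock

/-- Lattice points `A_{x,y} = (x, y)`. -/
abbrev Point := ℤ × ℤ

/-- Segments, i.e. unordered pairs of lattice points. -/
abbrev Edge := Sym2 Point

/-- The four diagonal steps. -/
def xSteps : Set Point := {(1, 1), (-1, 1), (1, -1), (-1, -1)}

/-- The sequence `v 0, …, v k` is an X-path: consecutive points differ by a diagonal step,
and the points are pairwise distinct. -/
def IsXPath {k : ℕ} (v : Fin (k + 1) → Point) : Prop :=
  (∀ j : Fin k, v j.succ - v j.castSucc ∈ xSteps) ∧ Function.Injective v

/-- The set of segments of the sequence `v 0, …, v k`. -/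
def pathEdges {k : ℕ} (v : Fin (k + 1) → Point) : Set Edge :=
  Set.range fun j : Fin k => s(v j.castSucc, v j.succ)

/-- A network drawn on the lattice, with its input (source) nodes and its output (terminus)
nodes. -/
structure Network where
  nodes : Set Point
  edges : Set Edge
  sources : Set Point
  termini : Set Point

/-- A pathset: a set of edges of the network that contains an X-path connecting a source node
with a terminus node. -/
def Network.IsPathset (N : Network) (P : Set Edge) : Prop :=
  P ⊆ N.edges ∧ ∃ (k : ℕ) (v : Fin (k + 1) → Point),
    IsXPath v ∧ v 0 ∈ N.sources ∧ v (Fin.last k) ∈ N.termini ∧ pathEdges v ⊆ P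

/-- A cutset: a set of edges of the network whose complement is not a pathset. -/
def Network.IsCutset (N : Network) (C : Set Edge) : Prop :=
  C ⊆ N.edges ∧ ¬ N.IsPathset (N.edges \ C)

/-- A minpath: a pathset that stops being one when any of its edges is removed. -/
def Network.IsMinpath (N : Network) (P : Set Edge) : Prop :=
  N.IsPathset P ∧ ∀ e ∈ P, ¬ N.IsPathset (P \ {e})

/-- A mincut: a cutset that stops being one when any of its edges is removed. -/
def Network.IsMincut (N : Network) (C : Set Edge) : Prop :=
  N.IsCutset C ∧ ∀ e ∈ C, ¬ N.IsCutset (C \ {e})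

/-- The two kinds of hammock networks. -/
inductive Kind
  | first
  | second

/-- The parity of the points used by a network of the given kind: even points for the first
kind, odd points for the second kind. -/
def Kind.Parity : Kind → Point → Prop
  | .first, a => Even (a.1 + a.2)
  | .second, a => Odd (a.1 + a.2)

/-- All lattice points of the rectangle `[0,l] × [0,w]`. -/
def allNodes (l w : ℕ) : Set Point :=
  {a | 0 ≤ a.1 ∧ a.1 ≤ l ∧ 0 ≤ a.2 ∧ a.2 ≤ w}

/-- All diagonal segments of length `√2` joining lattice points of the rectangle. -/
def allEdges (l w : ℕ) : Set Edge :=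
  {e | ∃ a b : Point, a ∈ allNodes l w ∧ b ∈ allNodes l w ∧
    |a.1 - b.1| = 1 ∧ |a.2 - b.2| = 1 ∧ e = s(a, b)}

/-- The nodes of the hammock network of kind `i`. -/
def kindNodes (i : Kind) (l w : ℕ) : Set Point :=
  {a | a ∈ allNodes l w ∧ i.Parity a}

/-- The edges of the hammock network of kind `i`: the segments with endpoints of the right
parity. -/
def kindEdges (i : Kind) (l w : ℕ) : Set Edge :=
  {e | e ∈ allEdges l w ∧ ∀ a ∈ e, i.Parity a}

/-- The hammock network of kind `i` and dimensions `(l, w)`: its source nodes are its nodes on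
the line `x = 0`, its terminus nodes are its nodes on the line `x = l`. -/
def hammock (i : Kind) (l w : ℕ) : Network where
  nodes := kindNodes i l w
  edges := kindEdges i l w
  sources := {a | a ∈ kindNodes i l w ∧ a.1 = 0}
  termini := {a | a ∈ kindNodes i l w ∧ a.1 = l}

/-- The dual network: the remaining lattice points and diagonal segments of the rectangle, with
the source nodes on the line `y = 0` and the terminus nodes on the line `y = w`. -/
def dualHammock (i : Kind) (l w : ℕ) : Network where
  nodes := allNodes l w \ kindNodes i l w
  edges := allEdges l w \ kindEdges i l w
  sources := {a | a ∈ allNodes l w \ kindNodes i l w ∧ a.2 = 0}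
  termini := {a | a ∈ allNodes l w \ kindNodes i l w ∧ a.2 = w}

/-- The complementary edge, which crosses the given one: it joins `(x', y)` and `(x, y')` if the
given edge joins `(x, y)` and `(x', y')`. -/
def compl : Edge → Edge :=
  Sym2.lift ⟨fun a b => s((b.1, a.2), (a.1, b.2)), fun _ _ => Sym2.eq_swap⟩

end Hammock

namespace Hammock

/-! Everything rests on `isPathset_dual_iff`: edges `S` of the hammock join left to right exactly
when the complements of the edges outside `S` do not join bottom to top. Applied to a set with and
without one edge, this carries minimality across.

Both connections cannot occur: the signed number of crossings of a left-right walk with downward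
half-lines stays 0 along a dual path avoiding it, but is 1 at the top
(`not_reachable_of_reachable`). One must occur: otherwise label 1 the points reached from the left
or, in the dual, from the bottom, and 0 the others. A count mod 2 gives a cell with both diagonals
bichromatic (`exists_cell_ne`), but one of the two is an available edge. -/

/-- A single congruence lets `omega` treat both kinds at once. -/
theorem Kind.exists_parity_iff (i : Kind) :
    ∃ κ : ℤ, ∀ a : Point, i.Parity a ↔ (a.1 + a.2 + κ) % 2 = 0 := by
  cases i
  · exact ⟨0, fun a => by simp [Kind.Parity, Int.even_iff]⟩
  · exact ⟨1, fun a => by simp only [Kind.Parity, Int.odd_iff]; omega⟩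

theorem mk_mem_allEdges {l w : ℕ} {a b : Point} :
    s(a, b) ∈ allEdges l w ↔
      a ∈ allNodes l w ∧ b ∈ allNodes l w ∧ |a.1 - b.1| = 1 ∧ |a.2 - b.2| = 1 := by
  constructor
  · rintro ⟨c, d, hc, hd, h1, h2, h⟩
    rcases Sym2.eq_iff.1 h with ⟨rfl, rfl⟩ | ⟨rfl, rfl⟩
    · exact ⟨hc, hd, h1, h2⟩
    · exact ⟨hd, hc, by rwa [abs_sub_comm], by rwa [abs_sub_comm]⟩
  · rintro ⟨ha, hb, h1, h2⟩
    exact ⟨a, b, ha, hb, h1, h2, rfl⟩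

theorem mk_mem_kindEdges {i : Kind} {l w : ℕ} {a b : Point} :
    s(a, b) ∈ kindEdges i l w ↔ s(a, b) ∈ allEdges l w ∧ i.Parity a ∧ i.Parity b := by
  simp only [kindEdges, Set.mem_ofPred_eq, Sym2.mem_iff, forall_eq_or_imp, forall_eq]

theorem compl_mk (a b : Point) : compl s(a, b) = s((b.1, a.2), (a.1, b.2)) := rfl

theorem compl_compl (e : Edge) : compl (compl e) = e := by
  induction e using Sym2.ind with
  | _ a b => rfl

theorem compl_injective : Function.Injective compl :=
  Function.LeftInverse.injective compl_compl

theorem compl_mem_allEdges {l w : ℕ} {e : Edge} (he : e ∈ allEdges l w) :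
    compl e ∈ allEdges l w := by
  induction e using Sym2.ind with
  | _ a b =>
    rw [mk_mem_allEdges] at he
    rw [compl_mk, mk_mem_allEdges]
    obtain ⟨⟨h1, h2, h3, h4⟩, ⟨h5, h6, h7, h8⟩, h9, h10⟩ := he
    exact ⟨⟨h5, h6, h3, h4⟩, ⟨h1, h2, h7, h8⟩, by rwa [abs_sub_comm], h10⟩

theorem compl_mem_kindEdges_iff {i : Kind} {l w : ℕ} {e : Edge} (he : e ∈ allEdges l w) :
    compl e ∈ kindEdges i l w ↔ e ∉ kindEdges i l w := by
  have hc := compl_mem_allEdges he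
  induction e using Sym2.ind with
  | _ a b =>
    obtain ⟨κ, hκ⟩ := i.exists_parity_iff
    rw [compl_mk] at hc ⊢
    rw [mk_mem_kindEdges, mk_mem_kindEdges]
    simp only [he, hc, true_and, hκ]
    obtain ⟨-, -, h1, h2⟩ := mk_mem_allEdges.1 he
    rw [abs_eq one_pos.le] at h1 h2
    omega

theorem image_compl_hammock_edges (i : Kind) (l w : ℕ) :
    compl '' (hammock i l w).edges = (dualHammock i l w).edges := by
  ext e
  constructor
  · rintro ⟨e, he, rfl⟩
    have h : e ∈ allEdges l w := he.1
    refine ⟨compl_mem_allEdges h, ?_⟩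
    rw [compl_mem_kindEdges_iff h]
    exact not_not.2 he
  · rintro ⟨he, hk⟩
    exact ⟨compl e, (compl_mem_kindEdges_iff he).2 hk, compl_compl e⟩

theorem sub_mem_xSteps {a b : Point} (h1 : |a.1 - b.1| = 1) (h2 : |a.2 - b.2| = 1) :
    b - a ∈ xSteps := by
  obtain ⟨a1, a2⟩ := a
  obtain ⟨b1, b2⟩ := b
  simp only [xSteps, Set.mem_insert_iff, Set.mem_singleton_iff, Prod.mk_sub_mk, Prod.mk.injEq]
  rw [abs_eq one_pos.le] at h1 h2
  simp only at h1 h2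
  omega

theorem ne_of_mk_mem_allEdges {l w : ℕ} {a b : Point} (h : s(a, b) ∈ allEdges l w) : a ≠ b := by
  rintro rfl
  have := (mk_mem_allEdges.1 h).2.2.1
  simp at this

/-- Pathsets of a network of diagonal segments, in terms of reachability. -/
theorem Network.isPathset_iff {N : Network} {l w : ℕ} (hN : N.edges ⊆ allEdges l w)
    {P : Set Edge} (hP : P ⊆ N.edges) :
    N.IsPathset P ↔ ∃ s ∈ N.sources, ∃ t ∈ N.termini,
      (SimpleGraph.fromEdgeSet P).Reachable s t := by
  constructor
  · rintro ⟨-, k, v, -, hs, ht, hv⟩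
    refine ⟨_, hs, _, ht, ?_⟩
    suffices h : ∀ j, (SimpleGraph.fromEdgeSet P).Reachable (v 0) (v j) from h _
    intro j
    induction j using Fin.induction with
    | zero => exact SimpleGraph.Reachable.refl _
    | succ j ih =>
      have hj : s(v j.castSucc, v j.succ) ∈ P := hv ⟨j, rfl⟩
      exact ih.trans (SimpleGraph.Adj.reachable
        ((SimpleGraph.fromEdgeSet_adj _).2 ⟨hj, ne_of_mk_mem_allEdges (hN (hP hj))⟩))
  · rintro ⟨s, hs, t, ht, ⟨q⟩⟩
    obtain ⟨p, hp⟩ := q.toPath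
    have hadj : ∀ j : Fin p.length, s(p.getVert j, p.getVert (j + 1)) ∈ P := fun j =>
      ((SimpleGraph.fromEdgeSet_adj _).1 (p.adj_getVert_succ j.2)).1
    refine ⟨hP, p.length, fun j => p.getVert j, ⟨fun j => ?_, fun a b hab => ?_⟩,
      by simpa using hs, by simpa using ht, ?_⟩
    · obtain ⟨-, -, h1, h2⟩ := mk_mem_allEdges.1 (hN (hP (hadj j)))
      exact sub_mem_xSteps h1 h2
    · exact Fin.ext (hp.getVert_injOn (Nat.le_of_lt_succ a.2) (Nat.le_of_lt_succ b.2) hab)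
    · rintro _ ⟨j, rfl⟩
      exact hadj j

/-! ### Crossing numbers: the two connections exclude each other -/

/-- Flow conservation for one step `u → v` on the part of the line at abscissa `x` below `y`. By
parity no endpoint is `(x, y)`, so an endpoint on that line lies below `y` exactly when the midpoint
of the step does. -/
theorem crossing_step {u v : Point} {κ x y : ℤ} (h1 : u.1 - v.1 = 1 ∨ u.1 - v.1 = -1)
    (h2 : u.2 - v.2 = 1 ∨ u.2 - v.2 = -1) (hu : (u.1 + u.2 + κ) % 2 = 0)
    (hv : (v.1 + v.2 + κ) % 2 = 0) (hxy : ¬ (x + y + κ) % 2 = 0) :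
    (if min u.1 v.1 = x - 1 ∧ min u.2 v.2 < y then v.1 - u.1 else 0) -
      (if min u.1 v.1 = x ∧ min u.2 v.2 < y then v.1 - u.1 else 0) =
      (if v.1 = x ∧ v.2 < y then 1 else 0) - (if u.1 = x ∧ u.2 < y then (1 : ℤ) else 0) := by
  have hux : u.1 = x → (u.2 < y ↔ min u.2 v.2 < y) := by omega
  have hvx : v.1 = x → (v.2 < y ↔ min u.2 v.2 < y) := by omega
  simp only [and_congr_right hux, and_congr_right hvx]
  clear hux hvx hu hv hxy h2
  by_cases hm : min u.2 v.2 < y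
  · simp only [hm, and_true]
    split_ifs <;> omega
  · simp only [hm, and_false, if_false]

/-- The signed crossing numbers `f x y` of a walk with the vertical half-lines going down from
`(x + 1/2, y)`. -/
theorem exists_crossing_number {i : Kind} {l w : ℕ} {S : Set Edge} (hS : S ⊆ kindEdges i l w)
    {s t : Point} (hst : (SimpleGraph.fromEdgeSet S).Reachable s t) :
    ∃ f : ℤ → ℤ → ℤ, (∀ x, f x 0 = 0) ∧
      (∀ x, f x w = (if s.1 ≤ x then 1 else 0) - (if t.1 ≤ x then 1 else 0)) ∧
      (∀ x y, ¬ i.Parity (x, y) → f (x - 1) y - f x y =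
        (if t.1 = x ∧ t.2 < y then 1 else 0) - (if s.1 = x ∧ s.2 < y then 1 else 0)) ∧
      ∀ a b : Point, ¬ i.Parity a → s(a, b) ∈ allEdges l w → compl s(a, b) ∉ S →
        f (min a.1 b.1) a.2 = f (min a.1 b.1) b.2 := by
  obtain ⟨p⟩ := hst
  induction p with
  | nil => exact ⟨fun _ _ => 0, by simp⟩
  | @cons u v t h p ih =>
    obtain ⟨f, h0, hw, hx, hd⟩ := ih
    have huv : s(u, v) ∈ S := ((SimpleGraph.fromEdgeSet_adj _).1 h).1
    obtain ⟨hall, hpu, hpv⟩ := mk_mem_kindEdges.1 (hS huv)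
    obtain ⟨⟨hu1, hu2, hu3, hu4⟩, ⟨hv1, hv2, hv3, hv4⟩, h1, h2⟩ := mk_mem_allEdges.1 hall
    obtain ⟨κ, hκ⟩ := i.exists_parity_iff
    rw [hκ] at hpu hpv
    rw [abs_eq one_pos.le] at h1 h2
    -- The step meets the line at `x + 1/2` at height `min u.2 v.2 + 1/2`; its sign is its
    -- direction.
    refine ⟨fun x y => f x y + if min u.1 v.1 = x ∧ min u.2 v.2 < y then v.1 - u.1 else 0,
      fun x => ?_, fun x => ?_, fun x y hxy => ?_, fun a b ha hab hS' => ?_⟩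
    · have := h0 x
      beta_reduce
      split_ifs <;> omega
    · have := hw x
      beta_reduce
      split_ifs at this ⊢ <;> omega
    · have := hx x y hxy
      rw [hκ] at hxy
      have step := crossing_step h1 h2 hpu hpv hxy
      beta_reduce
      linear_combination this + step
    · have := hd a b ha hab hS'
      rw [hκ] at ha
      beta_reduce
      rw [this]
      obtain ⟨-, -, h3, h4⟩ := mk_mem_allEdges.1 hab
      rw [abs_eq one_pos.le] at h3 h4
      -- The two half-lines differ only inside the cell of `s(a, b)`, whose only edge of the right
      -- parity is the complementary one.
      have hne : ¬ ((u.1 = b.1 ∧ u.2 = a.2 ∧ v.1 = a.1 ∧ v.2 = b.2) ∨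
          (u.1 = a.1 ∧ u.2 = b.2 ∧ v.1 = b.1 ∧ v.2 = a.2)) := by
        intro hc
        apply hS'
        rw [compl_mk]
        convert huv using 1
        simp only [Sym2.eq_iff, Prod.ext_iff]
        omega
      split_ifs <;> omega

/-- A left-right path of the hammock network and a bottom-top path of its dual cross. -/
theorem not_reachable_of_reachable {i : Kind} {l w : ℕ} (hl : 1 ≤ l) {S T : Set Edge}
    (hS : S ⊆ kindEdges i l w) (hT : T ⊆ (dualHammock i l w).edges)
    (hTS : ∀ e ∈ T, compl e ∉ S) {s t a b : Point}
    (hs : s.1 = 0) (ht : t.1 = l) (hst : (SimpleGraph.fromEdgeSet S).Reachable s t)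
    (ha : a ∈ (dualHammock i l w).sources) (hb : b ∈ (dualHammock i l w).termini) :
    ¬ (SimpleGraph.fromEdgeSet T).Reachable a b := by
  intro hab
  obtain ⟨f, h0, hw, hx, hd⟩ := exists_crossing_number hS hst
  obtain ⟨κ, hκ⟩ := i.exists_parity_iff
  obtain ⟨⟨ha1, ha2⟩, ha3⟩ := ha
  obtain ⟨⟨hb1, hb2⟩, hb3⟩ := hb
  -- Invariant: `f` vanishes in the columns of the rectangle adjacent to the point. On the top line
  -- it is 1 there, and `1 ≤ l` provides such a column.
  suffices h : (0 ≤ b.1 ∧ b.1 < l → f b.1 b.2 = 0) ∧ (0 < b.1 ∧ b.1 ≤ l → f (b.1 - 1) b.2 = 0) by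
    have h1 := hw b.1
    have h2 := hw (b.1 - 1)
    rw [hb3] at h
    obtain ⟨hb4, hb5, -⟩ := hb1
    split_ifs at h1 h2 <;> omega
  have key : (0 ≤ a.1 ∧ a.1 < l → f a.1 a.2 = 0) ∧
      (0 < a.1 ∧ a.1 ≤ l → f (a.1 - 1) a.2 = 0) := by
    rw [ha3, h0, h0]
    simp
  clear hb1 hb2 hb3 ha1 ha2 ha3
  obtain ⟨p⟩ := hab
  induction p with
  | nil => exact key
  | @cons u v b h p ih =>
    apply ih
    have huv : s(u, v) ∈ T := ((SimpleGraph.fromEdgeSet_adj _).1 h).1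
    obtain ⟨hall, hk⟩ := hT huv
    obtain ⟨⟨hu1, hu2, hu3, hu4⟩, ⟨hv1, hv2, hv3, hv4⟩, h1, h2⟩ := mk_mem_allEdges.1 hall
    rw [abs_eq one_pos.le] at h1 h2
    have hk' : ¬ (i.Parity u ∧ i.Parity v) := fun h => hk (mk_mem_kindEdges.2 ⟨hall, h⟩)
    have hpu : ¬ i.Parity u := by
      rw [hκ] at hk' ⊢
      rw [hκ] at hk'
      omega
    have hpv : ¬ i.Parity v := by
      rw [hκ] at hk' ⊢
      rw [hκ] at hk'
      omega
    -- `e1` transports the value within the column shared by `u` and `v`, `e2` to the other side of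
    -- `v`.
    have e1 := hd u v hpu hall (hTS _ huv)
    have e2 := hx v.1 v.2 hpv
    rcases h1 with h1 | h1
    · rw [min_eq_right (by omega), show v.1 = u.1 - 1 by omega] at e1
      rw [show v.1 = u.1 - 1 by omega] at e2 ⊢
      split_ifs at e2 <;> omega
    · rw [min_eq_left (by omega), show u.1 = v.1 - 1 by omega] at e1
      rw [show u.1 = v.1 - 1 by omega] at key
      split_ifs at e2 <;> omega

/-! ### Labelling mod 2: one of the two connections exists -/

/-- A `0`-`1` labelling of the rectangle that separates left from right on one parity class and
bottom from top on the other one takes both values on both diagonals of some cell. -/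
theorem exists_cell_ne (i : Kind) (l w : ℕ) (g : Point → ZMod 2)
    (hleft : ∀ y : ℕ, y ≤ w → i.Parity (0, y) → g (0, y) = 1)
    (hright : ∀ y : ℕ, y ≤ w → i.Parity (l, y) → g (l, y) = 0)
    (hbot : ∀ x : ℕ, x ≤ l → ¬ i.Parity (x, 0) → g (x, 0) = 1)
    (htop : ∀ x : ℕ, x ≤ l → ¬ i.Parity (x, w) → g (x, w) = 0) :
    ∃ x y : ℕ, x < l ∧ y < w ∧ g (x, y) ≠ g (x + 1, y + 1) ∧ g (x + 1, y) ≠ g (x, y + 1) := by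
  by_contra! hcell
  have two : (2 : ZMod 2) = 0 := rfl
  obtain ⟨κ, hκ⟩ := i.exists_parity_iff
  have hflip : ∀ x y : ℤ, i.Parity (x, y + 1) ↔ ¬ i.Parity (x, y) := fun x y => by
    rw [hκ, hκ]; simp only; omega
  have hflip' : ∀ x y : ℤ, i.Parity (x + 1, y) ↔ ¬ i.Parity (x, y) := fun x y => by
    rw [hκ, hκ]; simp only; omega
  let V : ℕ → ℕ → ZMod 2 := fun x y => g (x, y) * g (x, y + 1)
  let U : ℕ → ℕ → ZMod 2 := fun x y => g (x, y) * g (x + 1, y)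
  have hsum : ∑ x ∈ Finset.range l, ∑ y ∈ Finset.range w,
      ((V (x + 1) y - V x y) + (U x (y + 1) - U x y)) = 0 := by
    refine Finset.sum_eq_zero fun x hx => Finset.sum_eq_zero fun y hy => ?_
    -- Mod 2 this product expands to the sum of `V` and `U` over the four sides of the cell, so
    -- summing over cells leaves only the boundary.
    have hc : (g (x, y) + g (x + 1, y + 1)) * (g (x + 1, y) + g (x, y + 1)) = 0 := by
      by_cases h : g (x, y) = g (x + 1, y + 1)
      · rw [h]; linear_combination (g (x + 1, y + 1) * (g (x + 1, y) + g (x, y + 1))) * two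
      · rw [hcell x y (Finset.mem_range.1 hx) (Finset.mem_range.1 hy) h]
        linear_combination ((g (x, y) + g (x + 1, y + 1)) * g (x, y + 1)) * two
    simp only [V, U, Nat.cast_add, Nat.cast_one]
    linear_combination hc - (g (x, y) * g (x, y + 1) + g (x, y) * g (x + 1, y)) * two
  have hV : ∑ x ∈ Finset.range l, ∑ y ∈ Finset.range w, (V (x + 1) y - V x y) =
      ∑ y ∈ Finset.range w, V l y - ∑ y ∈ Finset.range w, V 0 y := by
    rw [Finset.sum_comm, ← Finset.sum_sub_distrib]
    exact Finset.sum_congr rfl fun y _ => Finset.sum_range_sub (fun x => V x y) l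
  have hU : ∑ x ∈ Finset.range l, ∑ y ∈ Finset.range w, (U x (y + 1) - U x y) =
      ∑ x ∈ Finset.range l, U x w - ∑ x ∈ Finset.range l, U x 0 := by
    rw [← Finset.sum_sub_distrib]
    exact Finset.sum_congr rfl fun x _ => Finset.sum_range_sub (fun y => U x y) w
  have hVl : ∑ y ∈ Finset.range w, V l y = 0 := by
    refine Finset.sum_eq_zero fun y hy => ?_
    rw [Finset.mem_range] at hy
    by_cases h : i.Parity (l, y)
    · simp only [V, hright y hy.le h, zero_mul]
    · have := hright (y + 1) hy (by push_cast; exact (hflip _ _).2 h)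
      push_cast at this
      simp only [V, this, mul_zero]
  have hUw : ∑ x ∈ Finset.range l, U x w = 0 := by
    refine Finset.sum_eq_zero fun x hx => ?_
    rw [Finset.mem_range] at hx
    by_cases h : i.Parity (x, w)
    · have := htop (x + 1) hx (by push_cast; rw [hflip']; exact not_not.2 h)
      push_cast at this
      simp only [U, this, mul_zero]
    · simp only [U, htop x hx.le h, zero_mul]
  -- Each side here has an end labelled 1, so `(1 + a) * (1 + b) = 0`, i.e. `a * b = a + b + 1` mod
  -- 2, and the sum telescopes.
  have hV0 : ∀ n ≤ w, ∑ y ∈ Finset.range n, V 0 y = g (0, 0) + g (0, n) + n := by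
    intro n hn
    induction n with
    | zero => simp only [Finset.range_zero, Finset.sum_empty, Nat.cast_zero]
              linear_combination -g (0, 0) * two
    | succ n ih =>
      rw [Finset.sum_range_succ, ih (by omega)]
      simp only [V, Nat.cast_zero, Nat.cast_add, Nat.cast_one]
      by_cases h : i.Parity (0, n)
      · rw [hleft n (by omega) h]
        linear_combination 0 * two
      · have := hleft (n + 1) hn (by push_cast; exact (hflip _ _).2 h)
        push_cast at this
        rw [this]
        linear_combination (g (0, n) - 1) * two
  have hU0 : ∀ n ≤ l, ∑ x ∈ Finset.range n, U x 0 = g (0, 0) + g (n, 0) + n := by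
    intro n hn
    induction n with
    | zero => simp only [Finset.range_zero, Finset.sum_empty, Nat.cast_zero]
              linear_combination -g (0, 0) * two
    | succ n ih =>
      rw [Finset.sum_range_succ, ih (by omega)]
      simp only [U, Nat.cast_zero, Nat.cast_add, Nat.cast_one]
      by_cases h : i.Parity (n, 0)
      · have := hbot (n + 1) hn (by push_cast; rw [hflip']; exact not_not.2 h)
        push_cast at this
        rw [this]
        linear_combination (g (n, 0) - 1) * two
      · rw [hbot n (by omega) h]
        linear_combination 0 * two
  have hcast : ∀ n : ℤ, (n : ZMod 2) = if n % 2 = 0 then 0 else 1 := by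
    intro n
    split_ifs with h
    · exact (ZMod.intCast_zmod_eq_zero_iff_dvd n 2).2 (by omega)
    · have := (ZMod.intCast_zmod_eq_zero_iff_dvd (n - 1) 2).2 (by omega)
      push_cast at this
      linear_combination this
  -- At this corner and at `(l, 0)` parity decides which boundary condition applies; with these
  -- values the boundary sum is 1.
  have hgw : g (0, w) = w + κ + 1 := by
    have h1 := hcast (w + κ)
    push_cast at h1
    rw [h1]
    split_ifs with h
    · rw [hleft w le_rfl ((hκ _).2 (by simpa using h))]; rfl
    · have := htop 0 (Nat.zero_le _) (by rw [hκ]; simpa using h)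
      push_cast at this
      rw [this]; rfl
  have hgl : g (l, 0) = l + κ := by
    have h1 := hcast (l + κ)
    push_cast at h1
    rw [h1]
    split_ifs with h
    · have := hright 0 (Nat.zero_le _) ((hκ _).2 (by simpa using h))
      push_cast at this
      rw [this]
    · rw [hbot l le_rfl (by rw [hκ]; simpa using h)]
  simp only [Finset.sum_add_distrib] at hsum
  rw [hV, hU, hVl, hUw, hV0 w le_rfl, hU0 l le_rfl, hgw, hgl] at hsum
  have : (1 : ZMod 2) = 0 := by
    linear_combination hsum + (g (0, 0) + w + κ + 1 + l) * two
  exact one_ne_zero this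

open Classical in
/-- If no set of edges of `S` connects left to right, then the dual edges of the remaining ones
connect bottom to top. -/
theorem exists_reachable_dual {i : Kind} {l w : ℕ} {S T : Set Edge}
    (hST : ∀ e ∈ kindEdges i l w, e ∉ S → compl e ∈ T)
    (hnot : ¬ ∃ s ∈ (hammock i l w).sources, ∃ t ∈ (hammock i l w).termini,
      (SimpleGraph.fromEdgeSet S).Reachable s t) :
    ∃ s ∈ (dualHammock i l w).sources, ∃ t ∈ (dualHammock i l w).termini,
      (SimpleGraph.fromEdgeSet T).Reachable s t := by
  by_contra hnot'
  let A : Point → Prop := fun p => ∃ s ∈ (hammock i l w).sources,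
    (SimpleGraph.fromEdgeSet S).Reachable s p
  let B : Point → Prop := fun p => ∃ s ∈ (dualHammock i l w).sources,
    (SimpleGraph.fromEdgeSet T).Reachable s p
  have hA : ∀ {a b : Point}, s(a, b) ∈ S → a ≠ b → (A a ↔ A b) := fun {a b} h hne =>
    have hr : (SimpleGraph.fromEdgeSet S).Reachable a b :=
      SimpleGraph.Adj.reachable ((SimpleGraph.fromEdgeSet_adj _).2 ⟨h, hne⟩)
    ⟨fun ⟨s, hs, h'⟩ => ⟨s, hs, h'.trans hr⟩, fun ⟨s, hs, h'⟩ => ⟨s, hs, h'.trans hr.symm⟩⟩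
  have hB : ∀ {a b : Point}, s(a, b) ∈ T → a ≠ b → (B a ↔ B b) := fun {a b} h hne =>
    have hr : (SimpleGraph.fromEdgeSet T).Reachable a b :=
      SimpleGraph.Adj.reachable ((SimpleGraph.fromEdgeSet_adj _).2 ⟨h, hne⟩)
    ⟨fun ⟨s, hs, h'⟩ => ⟨s, hs, h'.trans hr⟩, fun ⟨s, hs, h'⟩ => ⟨s, hs, h'.trans hr.symm⟩⟩
  let g : Point → ZMod 2 := fun p => if (if i.Parity p then A p else B p) then 1 else 0
  obtain ⟨x, y, hx, hy, h1, h2⟩ := exists_cell_ne i l w g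
    (fun y hy hp => by
      have : A (0, y) := ⟨_, ⟨⟨⟨by simp, by simp, by simp, by simpa using hy⟩, hp⟩, rfl⟩, .refl _⟩
      simp only [g, if_pos hp, if_pos this])
    (fun y hy hp => by
      have : ¬ A (l, y) := fun ⟨s, hs, h⟩ => hnot ⟨s, hs, _,
        ⟨⟨⟨by simp, by simp, by simp, by simpa using hy⟩, hp⟩, rfl⟩, h⟩
      simp only [g, if_pos hp, if_neg this])
    (fun x hx hp => by
      have : B (x, 0) := ⟨_, ⟨⟨⟨by simp, by simpa using hx, by simp, by simp⟩,
        fun h => hp h.2⟩, rfl⟩, .refl _⟩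
      simp only [g, if_neg hp, if_pos this])
    (fun x hx hp => by
      have : ¬ B (x, w) := fun ⟨s, hs, h⟩ => hnot' ⟨s, hs, _,
        ⟨⟨⟨by simp, by simpa using hx, by simp, by simp⟩, fun h => hp h.2⟩, rfl⟩, h⟩
      simp only [g, if_neg hp, if_neg this])
  -- A bichromatic diagonal of the hammock is not in `S`, so the crossing one is in `T` and
  -- monochromatic.
  have hdiag : ∀ a b : Point, s(a, b) ∈ kindEdges i l w → g a ≠ g b →
      ¬ i.Parity (b.1, a.2) → ¬ i.Parity (a.1, b.2) → g (b.1, a.2) = g (a.1, b.2) := by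
    intro a b hab hne hp1 hp2
    obtain ⟨hall, hpa, hpb⟩ := mk_mem_kindEdges.1 hab
    have hS : s(a, b) ∉ S := fun h => hne (by
      simp only [g, if_pos hpa, if_pos hpb, hA h (ne_of_mk_mem_allEdges hall)])
    simp only [g, if_neg hp1, if_neg hp2,
      hB (hST _ hab hS) (ne_of_mk_mem_allEdges (compl_mem_allEdges hall))]
  obtain ⟨κ, hκ⟩ := i.exists_parity_iff
  have hall : s(((x : ℤ), (y : ℤ)), ((x : ℤ) + 1, (y : ℤ) + 1)) ∈ allEdges l w := by
    rw [mk_mem_allEdges]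
    refine ⟨⟨?_, ?_, ?_, ?_⟩, ⟨?_, ?_, ?_, ?_⟩, ?_, ?_⟩ <;> simp <;> omega
  by_cases hp : i.Parity (x, y)
  · refine h2 (hdiag (x, y) (x + 1, y + 1) (mk_mem_kindEdges.2 ⟨hall, hp, ?_⟩) h1 ?_ ?_) <;>
      rw [hκ] at hp ⊢ <;> simp only at hp ⊢ <;> omega
  · refine h1 (hdiag (x + 1, y) (x, y + 1)
      (mk_mem_kindEdges.2 ⟨compl_mem_allEdges hall, ?_, ?_⟩) h2 ?_ ?_) <;>
      rw [hκ] at hp ⊢ <;> simp only at hp ⊢ <;> omega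

/-! ### Duality of pathsets and cutsets -/

theorem isPathset_dual_iff {i : Kind} {l w : ℕ} (hl : 1 ≤ l) {S : Set Edge}
    (hS : S ⊆ (hammock i l w).edges) :
    (dualHammock i l w).IsPathset (compl '' ((hammock i l w).edges \ S)) ↔
      ¬ (hammock i l w).IsPathset S := by
  have hT : compl '' ((hammock i l w).edges \ S) ⊆ (dualHammock i l w).edges := by
    rw [← image_compl_hammock_edges]
    exact Set.image_mono Set.sdiff_subset
  have hH : (hammock i l w).edges ⊆ allEdges l w := fun e he => he.1
  have hD : (dualHammock i l w).edges ⊆ allEdges l w := fun e he => he.1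
  rw [Network.isPathset_iff hH hS, Network.isPathset_iff hD hT]
  constructor
  · rintro ⟨a, ha, b, hb, hab⟩ ⟨s, hs, t, ht, hst⟩
    refine not_reachable_of_reachable hl hS hT ?_ hs.2 ht.2 hst ha hb hab
    rintro _ ⟨e, he, rfl⟩
    rw [compl_compl]
    exact he.2
  · exact exists_reachable_dual fun e he heS => ⟨e, ⟨he, heS⟩, rfl⟩

theorem isPathset_image_compl_iff {i : Kind} {l w : ℕ} (hl : 1 ≤ l) {C : Set Edge}
    (hC : C ⊆ (hammock i l w).edges) :
    (dualHammock i l w).IsPathset (compl '' C) ↔ (hammock i l w).IsCutset C := by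
  have h := isPathset_dual_iff hl (Set.sdiff_subset (s := (hammock i l w).edges) (t := C))
  rw [Set.sdiff_sdiff_cancel_left hC] at h
  rw [h]
  exact ⟨fun h => ⟨hC, h⟩, fun h => h.2⟩

theorem isCutset_image_compl_iff {i : Kind} {l w : ℕ} (hl : 1 ≤ l) {P : Set Edge}
    (hP : P ⊆ (hammock i l w).edges) :
    (dualHammock i l w).IsCutset (compl '' P) ↔ (hammock i l w).IsPathset P := by
  have hsub : compl '' P ⊆ (dualHammock i l w).edges := by
    rw [← image_compl_hammock_edges]
    exact Set.image_mono hP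
  rw [Network.IsCutset, ← image_compl_hammock_edges, ← Set.image_sdiff compl_injective,
    isPathset_dual_iff hl hP, not_not, image_compl_hammock_edges]
  exact and_iff_right hsub

end Hammock

theorem theorem1 (i : Hammock.Kind) (l w : ℕ) (hl : 1 ≤ l) (hw : 1 ≤ w)
    (E : Set Hammock.Edge) (hE : E ⊆ (Hammock.hammock i l w).edges) :
    ((Hammock.hammock i l w).IsMincut E →
      (Hammock.dualHammock i l w).IsMinpath (Hammock.compl '' E)) ∧
    ((Hammock.hammock i l w).IsMinpath E →
      (Hammock.dualHammock i l w).IsMincut (Hammock.compl '' E)) := by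
  -- Deleting an edge commutes with complementation, so both minimality conditions reduce to the
  -- equivalences for `E \ {e}`.
  have hdiff : ∀ e, Hammock.compl '' E \ {Hammock.compl e} = Hammock.compl '' (E \ {e}) :=
    fun e => by rw [Set.image_sdiff Hammock.compl_injective, Set.image_singleton]
  have hsub : ∀ e, E \ {e} ⊆ (Hammock.hammock i l w).edges := fun e => Set.sdiff_subset.trans hE
  constructor
  · rintro ⟨hcut, hmin⟩
    refine ⟨(Hammock.isPathset_image_compl_iff hl hE).2 hcut, ?_⟩
    rintro _ ⟨e, he, rfl⟩
    rw [hdiff, Hammock.isPathset_image_compl_iff hl (hsub e)]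
    exact hmin e he
  · rintro ⟨hpath, hmin⟩
    refine ⟨(Hammock.isCutset_image_compl_iff hl hE).2 hpath, ?_⟩
    rintro _ ⟨e, he, rfl⟩
    rw [hdiff, Hammock.isCutset_image_compl_iff hl (hsub e)]
    exact hmin e he
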